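/- All homology is with coefficients in $\mathbb Z_2$. Let $K$ be a finite simplicial complex (a finite family of non-empty finite sets, closed under non-empty subsets; possibly empty). For $p\in\mathbb Z$ let $K^{(p)}$ be the set of $p$-simplices and let $K[p]$ be the $\mathbb Z_2$-vector space with basis $K^{(p)}$ (subsets of $K^{(p)}$ with symmetric difference), with $\partial_p:K[p]\to K[p-1]$ and $\delta_p:K[p]\to K[p+1]$ the simplicial boundary and coboundary. A Morse sequence $W$ on $K$ is a sequence of simplicial complexes $\emptyset=K_0,\dots,K_k=K$ such that for each $i\ge 1$ either $K_{i-1}=K_i\setminus\{\nu\}$ with $\nu$ a facet of $K_i$ (then $\nu$ is critical), or $K_{i-1}=K_i\setminus\{\sigma,\tau\}$ where $\tau$ is the only face of $K_i$ strictly containing $\sigma\in K_i$ (then $\sigma$ is lower regular and $\tau$ is upper regular). Let $\widehat W[p]\subseteq K[p]$ be the subspace of chains all of whose simplices are critical. A frame $\Upsilon$ assigns to each $p$-simplex of $K$, for every $p$, an element of $\widehat W[p]$; it extends linearly to $\Upsilon_p:K[p]\to\widehat W[p]$. A reference map $\curlywedge$ is a frame with $\curlywedge(\nu)=\nu$ for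 $\nu$ critical and $\curlywedge(\tau)=0$, $\curlywedge(\partial\tau)=0$ for $\tau$ upper regular; a coreference map $\curlyvee$ is a frame with $\curlyvee(\nu)=\nu$ for $\nu$ critical and $\curlyvee(\sigma)=0$, $\curlyvee(\delta\sigma)=0$ for $\sigma$ lower regular. Set $\widehat\partial_p=\curlywedge_{p-1}\circ\partial_p$ and $\widehat\delta_p=\curlyvee_{p+1}\circ\delta_p$ on $\widehat W[p]$. The extension map $\widetilde\curlywedge_p$ and the coextension map $\widetilde\curlyvee_p$ are the linear maps $\widehat W[p]\to K[p]$ with $\widetilde\curlywedge(\kappa)=\{\nu\in K:\kappa\in\curlyvee(\nu)\}$ and $\widetilde\curlyvee(\kappa)=\{\nu\in K:\kappa\in\curlywedge(\nu)\}$ for every critical $p$-simplex $\kappa$. Theorem. Let $W$ be a Morse sequence on $K$. There are a unique reference map $\curlywedge$ and a unique coreference map $\curlyvee$ for $W$. The pairs $(K[p],\partial_p)$ and $(\widehat W[p],\widehat\partial_p)$ are chain complexes, $(K[p],\delta_p)$ and $(\widehat W[p],\widehat\delta_p)$ are cochain complexes, $\curlywedge$ and $\widetilde\curlywedge$ are chain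 maps, and $\curlyvee$ and $\widetilde\curlyvee$ are cochain maps. For every $p\in\mathbb Z$: 1. $[z]\mapsto[\curlywedge_p(z)]$ and $[w]\mapsto[\widetilde\curlywedge_p(w)]$ are well-defined, mutually inverse linear isomorphisms between the homology $H_p(K)$ of $(K[p],\partial_p)$ and the homology $H_p(\widehat W)$ of $(\widehat W[p],\widehat\partial_p)$. 2. $[z]\mapsto[\curlyvee_p(z)]$ and $[w]\mapsto[\widetilde\curlyvee_p(w)]$ are well-defined, mutually inverse linear isomorphisms between the cohomology $H^p(K)$ of $(K[p],\delta_p)$ and the cohomology $H^p(\widehat W)$ of $(\widehat W[p],\widehat\delta_p)$. -/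

import Mathlib

noncomputable section

namespace MorseSeq

/-! ### Homology of a composable pair of linear maps -/

section Homology

variable {R A B C A' B' C' : Type*} [Ring R]
  [AddCommGroup A] [Module R A] [AddCommGroup B] [Module R B] [AddCommGroup C] [Module R C]
  [AddCommGroup A'] [Module R A'] [AddCommGroup B'] [Module R B'] [AddCommGroup C'] [Module R C']

/-- The homology `ker g / im f` at `B` of `A --f--> B --g--> C` (used when `g ∘ f = 0`). -/
abbrev Homology (f : A →ₗ[R] B) (g : B →ₗ[R] C) : Type _ :=
  LinearMap.ker g ⧸ (LinearMap.range f).submoduleOf (LinearMap.ker g)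

/-- The class `[z]` of a cycle `z`. -/
def homologyClass (f : A →ₗ[R] B) (g : B →ₗ[R] C) : LinearMap.ker g →ₗ[R] Homology f g :=
  Submodule.mkQ _

/-- `e` is the map `[z] ↦ [φ z]`: for every cycle `z`, the element `φ z` is a cycle and
`e [z] = [φ z]`. -/
def IsInducedBy {f : A →ₗ[R] B} {g : B →ₗ[R] C} {f' : A' →ₗ[R] B'} {g' : B' →ₗ[R] C'}
    (e : Homology f g →ₗ[R] Homology f' g') (φ : B →ₗ[R] B') : Prop :=
  ∀ z : LinearMap.ker g, ∃ h : φ z ∈ LinearMap.ker g',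
    e (homologyClass f g z) = homologyClass f' g' ⟨φ z, h⟩

end Homology

/-! ### Chains modulo 2 of a finite simplicial complex -/

section Chains

variable {V : Type*} (K : PreAbstractSimplicialComplex V)

/-- The `p`-simplices of `K`, `p ∈ ℤ`: the faces with `p + 1` elements. -/
abbrev Simplex (p : ℤ) : Type _ := {s : Finset V // s ∈ K ∧ (s.card : ℤ) = p + 1}

/-- The `p`-chains modulo 2: a set of `p`-simplices is identified with the corresponding formal
sum, the symmetric difference being the addition. -/
abbrev Chain (p : ℤ) : Type _ := Simplex K p →₀ ZMod 2

instance [Finite K] (p : ℤ) : Finite (Simplex K p) :=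
  Finite.of_injective (fun s => (⟨s.1, s.2.1⟩ : K)) fun s t h => by
    simpa [Subtype.ext_iff] using h

/-- The chain `∑_{σ ∈ S} σ` of a set `S` of simplices. -/
def chainOf {α : Type*} [Finite α] (S : Set α) : α →₀ ZMod 2 :=
  Finsupp.equivFunOnFinite.symm (S.indicator 1)

variable [Finite K]

/-- The boundary operator. `boundary K p (p - 1)` is `∂_p`; as for homological complexes, the
components `K[p] → K[q]` with `q ≠ p - 1` are zero. -/
def boundary (p q : ℤ) : Chain K p →ₗ[ZMod 2] Chain K q :=
  Finsupp.linearCombination (ZMod 2)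
    (fun σ : Simplex K p => chainOf {τ : Simplex K q | q = p - 1 ∧ τ.1 ⊂ σ.1})

/-- The coboundary operator. `coboundary K p (p + 1)` is `δ^p`; the components `K[p] → K[q]` with
`q ≠ p + 1` are zero. -/
def coboundary (p q : ℤ) : Chain K p →ₗ[ZMod 2] Chain K q :=
  Finsupp.linearCombination (ZMod 2)
    (fun σ : Simplex K p => chainOf {τ : Simplex K q | q = p + 1 ∧ σ.1 ⊂ τ.1})

end Chains

/-! ### Morse sequences -/

section Sequences

variable {V : Type*}

/-- `K` is the elementary filling `L ∪ {ν}` of `L`: `ν` is a facet of `K` and `L = K \ {ν}`. -/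
def IsFilling (L K : PreAbstractSimplicialComplex V) (ν : Finset V) : Prop :=
  Maximal (· ∈ K) ν ∧ L.faces = K.faces \ {ν}

/-- `(σ, τ)` is a free pair for `K`: `τ` is the only face of `K` that strictly contains `σ`. -/
def IsFreePair (K : PreAbstractSimplicialComplex V) (σ τ : Finset V) : Prop :=
  σ ∈ K ∧ τ ∈ K ∧ ∀ ρ ∈ K, σ ⊂ ρ ↔ ρ = τ

/-- `K` is the elementary expansion `L ∪ {σ, τ}` of `L`. -/
def IsExpansion (L K : PreAbstractSimplicialComplex V) (σ τ : Finset V) : Prop :=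
  IsFreePair K σ τ ∧ L.faces = K.faces \ {σ, τ}

/-- A Morse sequence `⟨∅ = K₀, …, K_k = K⟩` on `K`. -/
structure MorseSequence (K : PreAbstractSimplicialComplex V) where
  /-- the number `k` of steps -/
  length : ℕ
  /-- the complexes `K₀, …, K_k` -/
  cplx : Fin (length + 1) → PreAbstractSimplicialComplex V
  first : cplx 0 = ⊥
  last : cplx (Fin.last length) = K
  step : ∀ i : Fin length,
    (∃ σ τ, IsExpansion (cplx i.castSucc) (cplx i.succ) σ τ) ∨
      ∃ ν, IsFilling (cplx i.castSucc) (cplx i.succ) ν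

variable {K : PreAbstractSimplicialComplex V}

namespace MorseSequence

variable (W : MorseSequence K)

/-- The critical faces: those added by the fillings. -/
def IsCritical (ν : Finset V) : Prop :=
  ∃ i : Fin W.length, IsFilling (W.cplx i.castSucc) (W.cplx i.succ) ν

/-- The regular pairs: those added by the expansions. -/
def IsRegularPair (σ τ : Finset V) : Prop :=
  ∃ i : Fin W.length, IsExpansion (W.cplx i.castSucc) (W.cplx i.succ) σ τ

def IsLowerRegular (σ : Finset V) : Prop := ∃ τ, W.IsRegularPair σ τ

def IsUpperRegular (τ : Finset V) : Prop := ∃ σ, W.IsRegularPair σ τ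

/-- `Ŵ[p]`: the subspace of the `p`-chains of `K` all of whose simplices are critical. -/
def criticalChains (p : ℤ) : Submodule (ZMod 2) (Chain K p) :=
  Finsupp.supported (ZMod 2) (ZMod 2) {ν : Simplex K p | W.IsCritical ν.1}

/-- A frame assigns to each `p`-simplex of `K` an element of `Ŵ[p]`, for every `p`. -/
abbrev Frame : Type _ := ∀ p : ℤ, Simplex K p → W.criticalChains p

end MorseSequence

open MorseSequence

variable {W : MorseSequence K}

/-- The linear extension `Υ_p : K[p] → Ŵ[p]` of a frame `Υ`. -/
def frameMap (Υ : W.Frame) (p : ℤ) : Chain K p →ₗ[ZMod 2] W.criticalChains p :=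
  Finsupp.linearCombination (ZMod 2) (Υ p)

variable [Finite K]

/-- `Υ` is a reference map `⋏`. -/
structure IsReferenceMap (Υ : W.Frame) : Prop where
  critical : ∀ (p : ℤ) (ν : Simplex K p), W.IsCritical ν.1 →
    (Υ p ν : Chain K p) = Finsupp.single ν 1
  upper : ∀ (p : ℤ) (τ : Simplex K p), W.IsUpperRegular τ.1 → Υ p τ = 0
  boundary_upper : ∀ (p : ℤ) (τ : Simplex K p), W.IsUpperRegular τ.1 →
    frameMap Υ (p - 1) (boundary K p (p - 1) (Finsupp.single τ 1)) = 0

/-- `Υ` is a coreference map `⋎`. -/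
structure IsCoreferenceMap (Υ : W.Frame) : Prop where
  critical : ∀ (p : ℤ) (ν : Simplex K p), W.IsCritical ν.1 →
    (Υ p ν : Chain K p) = Finsupp.single ν 1
  lower : ∀ (p : ℤ) (σ : Simplex K p), W.IsLowerRegular σ.1 → Υ p σ = 0
  coboundary_lower : ∀ (p : ℤ) (σ : Simplex K p), W.IsLowerRegular σ.1 →
    frameMap Υ (p + 1) (coboundary K p (p + 1) (Finsupp.single σ 1)) = 0

/-- The boundary of the critical complex: `∂̂_p = ⋏_{p-1} ∘ ∂_p` on `Ŵ[p]` is the component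
`q = p - 1`. -/
def criticalBoundary (ref : W.Frame) (p q : ℤ) :
    W.criticalChains p →ₗ[ZMod 2] W.criticalChains q :=
  frameMap ref q ∘ₗ boundary K p q ∘ₗ (W.criticalChains p).subtype

/-- The coboundary of the cocritical complex: `δ̂_p = ⋎_{p+1} ∘ δ^p` on `Ŵ[p]` is the component
`q = p + 1`. -/
def cocriticalCoboundary (coref : W.Frame) (p q : ℤ) :
    W.criticalChains p →ₗ[ZMod 2] W.criticalChains q :=
  frameMap coref q ∘ₗ coboundary K p q ∘ₗ (W.criticalChains p).subtype

/-- The linear map `Ŵ[p] → K[p]` with `κ ↦ {ν ∈ K | κ ∈ Υ(ν)}` for critical `κ`. -/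
def transposeMap (Υ : W.Frame) (p : ℤ) : W.criticalChains p →ₗ[ZMod 2] Chain K p :=
  Finsupp.linearCombination (ZMod 2)
      (fun κ : Simplex K p => chainOf {ν : Simplex K p | κ ∈ (Υ p ν : Chain K p).support}) ∘ₗ
    (W.criticalChains p).subtype

/-- The extension map, `κ ↦ {ν ∈ K | κ ∈ ⋎(ν)}`; it is built from the coreference map. -/
def extensionMap (coref : W.Frame) (p : ℤ) : W.criticalChains p →ₗ[ZMod 2] Chain K p :=
  transposeMap coref p

/-- The coextension map, `κ ↦ {ν ∈ K | κ ∈ ⋏(ν)}`; it is built from the reference map. -/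
def coextensionMap (ref : W.Frame) (p : ℤ) : W.criticalChains p →ₗ[ZMod 2] Chain K p :=
  transposeMap ref p

end Sequences

section HomologySpaces

variable {V : Type*} (K : PreAbstractSimplicialComplex V) [Finite K]

/-- `H_p(K)`, modulo 2. -/
abbrev SimplicialHomology (p : ℤ) : Type _ :=
  Homology (boundary K (p + 1) p) (boundary K p (p - 1))

/-- `H^p(K)`, modulo 2. -/
abbrev SimplicialCohomology (p : ℤ) : Type _ :=
  Homology (coboundary K (p - 1) p) (coboundary K p (p + 1))

variable {K} {W : MorseSequence K}

/-- `H_p(Ŵ)`, the homology of the critical complex. -/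
abbrev CriticalHomology (ref : W.Frame) (p : ℤ) : Type _ :=
  Homology (criticalBoundary ref (p + 1) p) (criticalBoundary ref p (p - 1))

/-- `H^p(Ŵ)`, the cohomology of the cocritical complex. -/
abbrev CocriticalCohomology (coref : W.Frame) (p : ℤ) : Type _ :=
  Homology (cocriticalCoboundary coref (p - 1) p) (cocriticalCoboundary coref p (p + 1))

end HomologySpaces

end MorseSeq

end

open MorseSeq

open MorseSeq

namespace MorseSeq

/-! ### Combinatorics of fillings, expansions and regular pairs -/

section Combinatorics

variable {V : Type*} {L K : PreAbstractSimplicialComplex V} {ν σ τ ρ : Finset V}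

/-! For a regular pair $(\sigma,\tau)$, the boundary $\partial\tau$ is $\sigma$ plus faces added
earlier in the sequence. By triangularity, the critical $p$-simplices, the upper regular
$p$-simplices and the boundaries of the upper regular $(p+1)$-simplices span $K[p]$
(`span_generators_boundary`). The regular pairing matches these generators with the $p$-simplices,
so they form a basis. The reference map is the projection to the critical span along the other two
families: it exists (`exists_frameMap`), is unique, and commutes with the differentials, as one
checks on generators using $\partial\partial=0$.

Dually, $\delta\sigma$ is $\tau$ plus faces added later, which gives coreference maps. The extension
map is the transpose of the coreference map. So the extension of $\kappa$ agrees with $\kappa$ on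
critical faces and vanishes on lower regular faces, as does its boundary. These conditions determine
a chain, because the dual generators span (`eq_zero_of_orthogonal`). Hence
$\curlywedge\circ\widetilde\curlywedge=\mathrm{id}$ and $\widetilde\curlywedge$ is a chain map.

For a cycle $z$, the chain $\widetilde\curlywedge(\curlywedge z)-z$ is a cycle killed by
$\curlywedge$, so it is $u+\partial v$ with $u$ made of upper regular faces and $\partial u=0$. The
same determinacy forces $u=0$ (`IsReferenceFor.mem_range`), so the two maps are inverse in homology.
`IsAcyclicMatching` collects what is used; exchanging boundary with coboundary and upper with lower
gives cohomology. -/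

theorem IsFilling.mem_iff (h : IsFilling L K ν) : ρ ∈ L ↔ ρ ∈ K ∧ ρ ≠ ν := by
  change ρ ∈ L.faces ↔ ρ ∈ K.faces ∧ _
  simp [h.2]

theorem IsExpansion.mem_iff (h : IsExpansion L K σ τ) : ρ ∈ L ↔ ρ ∈ K ∧ ρ ≠ σ ∧ ρ ≠ τ := by
  change ρ ∈ L.faces ↔ ρ ∈ K.faces ∧ _
  simp [h.2]

theorem IsFreePair.ssubset (h : IsFreePair K σ τ) : σ ⊂ τ := (h.2.2 τ h.2.1).2 rfl

theorem mem_of_subset (hσ : σ ∈ K) (hρ : ρ ⊆ σ) (hne : ρ.Nonempty) : ρ ∈ K :=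
  (K.isRelLowerSet_faces hσ).2 hρ hne

theorem nonempty_of_mem (hσ : σ ∈ K) : σ.Nonempty := (K.isRelLowerSet_faces hσ).1

/-- Adding to `σ` one vertex of `τ \ σ` gives a face strictly containing `σ`, and `τ` is the only
such face. -/
theorem IsFreePair.card_eq (h : IsFreePair K σ τ) : τ.card = σ.card + 1 := by
  classical
  obtain ⟨a, ha, haσ⟩ := Finset.exists_of_ssubset h.ssubset
  have hK : insert a σ ∈ K :=
    mem_of_subset h.2.1 (Finset.insert_subset ha h.ssubset.1) (Finset.insert_nonempty _ _)
  rw [← (h.2.2 _ hK).1 (Finset.ssubset_insert haσ), Finset.card_insert_of_notMem haσ]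

namespace MorseSequence

variable (W : MorseSequence K)

theorem cplx_monotone : Monotone W.cplx := by
  rw [Fin.monotone_iff_le_succ]
  intro i ρ hρ
  rcases W.step i with ⟨σ, τ, h⟩ | ⟨ν, h⟩
  · exact (h.mem_iff.1 hρ).1
  · exact (h.mem_iff.1 hρ).1

theorem mem_of_mem_cplx {j : Fin (W.length + 1)} (h : ρ ∈ W.cplx j) : ρ ∈ K := by
  have := W.cplx_monotone (Fin.le_last j) h
  rwa [W.last] at this

variable {W}

/-- The complexes increase, so each face enters at a single step; this is what makes the critical
and regular types exclusive. -/
theorem step_unique {i j : Fin W.length} (hi : ρ ∈ W.cplx i.succ) (hi' : ρ ∉ W.cplx i.castSucc)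
    (hj : ρ ∈ W.cplx j.succ) (hj' : ρ ∉ W.cplx j.castSucc) : i = j := by
  rcases lt_trichotomy i j with h | h | h
  · exact absurd (W.cplx_monotone (Fin.succ_le_castSucc_iff.2 h) hi) hj'
  · exact h
  · exact absurd (W.cplx_monotone (Fin.succ_le_castSucc_iff.2 h) hj) hi'

theorem IsRegularPair.isFreePair_exists (h : W.IsRegularPair σ τ) : ∃ L ≤ K, IsFreePair L σ τ := by
  obtain ⟨i, hi⟩ := h
  exact ⟨_, fun _ => W.mem_of_mem_cplx, hi.1⟩

theorem IsRegularPair.ssubset (h : W.IsRegularPair σ τ) : σ ⊂ τ :=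
  let ⟨_, _, h⟩ := h.isFreePair_exists; h.ssubset

theorem IsRegularPair.card_eq (h : W.IsRegularPair σ τ) : τ.card = σ.card + 1 :=
  let ⟨_, _, h⟩ := h.isFreePair_exists; h.card_eq

theorem IsRegularPair.left_mem (h : W.IsRegularPair σ τ) : σ ∈ K :=
  let ⟨_, hL, h⟩ := h.isFreePair_exists; hL h.1

theorem IsRegularPair.right_mem (h : W.IsRegularPair σ τ) : τ ∈ K :=
  let ⟨_, hL, h⟩ := h.isFreePair_exists; hL h.2.1

/-- Two regular pairs with a common face coincide. -/
theorem IsRegularPair.eq_of_mem {σ' τ' : Finset V} (h : W.IsRegularPair σ τ)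
    (h' : W.IsRegularPair σ' τ') (hρ : ρ = σ ∨ ρ = τ) (hρ' : ρ = σ' ∨ ρ = τ') :
    σ = σ' ∧ τ = τ' := by
  have hs := h.ssubset
  have hs' := h'.ssubset
  obtain ⟨i, hi⟩ := h
  obtain ⟨j, hj⟩ := h'
  have key : i = j := by
    refine step_unique (ρ := ρ) ?_ ?_ ?_ ?_
    · rcases hρ with rfl | rfl
      exacts [hi.1.1, hi.1.2.1]
    · rw [hi.mem_iff]; tauto
    · rcases hρ' with rfl | rfl
      exacts [hj.1.1, hj.1.2.1]
    · rw [hj.mem_iff]; tauto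
  subst key
  -- At the common step, `{σ, τ}` and `{σ', τ'}` have the same complement in the same complex.
  have h1 : σ = σ' ∨ σ = τ' := by
    by_contra hc
    exact (hi.mem_iff.1 (hj.mem_iff.2 ⟨hi.1.1, not_or.1 hc⟩)).2.1 rfl
  have h2 : τ = σ' ∨ τ = τ' := by
    by_contra hc
    exact (hi.mem_iff.1 (hj.mem_iff.2 ⟨hi.1.2.1, not_or.1 hc⟩)).2.2 rfl
  rcases h1 with rfl | rfl <;> rcases h2 with rfl | rfl
  · exact absurd hs (ssubset_irrefl _)
  · exact ⟨rfl, rfl⟩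
  · exact absurd (hs.trans hs') (ssubset_irrefl _)
  · exact absurd hs (ssubset_irrefl _)

/-- A common face would place both at the same step, which would then remove one face and also two.
-/
theorem IsCritical.not_isRegularPair (h : W.IsCritical ν) (h' : W.IsRegularPair σ τ) :
    ν ≠ σ ∧ ν ≠ τ := by
  have hs := h'.ssubset
  by_contra hc
  have hν : ν = σ ∨ ν = τ := by tauto
  obtain ⟨i, hi⟩ := h
  obtain ⟨j, hj⟩ := h'
  have key : i = j := by
    refine step_unique (ρ := ν) hi.1.1 ?_ ?_ ?_
    · rw [hi.mem_iff]; tauto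
    · rcases hν with rfl | rfl
      exacts [hj.1.1, hj.1.2.1]
    · rw [hj.mem_iff]; tauto
  subst key
  have h1 : σ = ν := by
    by_contra hc
    exact (hj.mem_iff.1 (hi.mem_iff.2 ⟨hj.1.1, hc⟩)).2.1 rfl
  have h2 : τ = ν := by
    by_contra hc
    exact (hj.mem_iff.1 (hi.mem_iff.2 ⟨hj.1.2.1, hc⟩)).2.2 rfl
  exact hs.ne (h1.trans h2.symm)

theorem IsLowerRegular.not_isUpperRegular (h : W.IsLowerRegular ρ) : ¬ W.IsUpperRegular ρ := by
  rintro ⟨σ, hσ⟩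
  obtain ⟨τ, hτ⟩ := h
  obtain ⟨rfl, rfl⟩ := hτ.eq_of_mem hσ (Or.inl rfl) (Or.inr rfl)
  exact ssubset_irrefl _ hσ.ssubset

theorem IsCritical.not_isLowerRegular (h : W.IsCritical ρ) : ¬ W.IsLowerRegular ρ :=
  fun ⟨_, hτ⟩ => (h.not_isRegularPair hτ).1 rfl

theorem IsCritical.not_isUpperRegular (h : W.IsCritical ρ) : ¬ W.IsUpperRegular ρ :=
  fun ⟨_, hτ⟩ => (h.not_isRegularPair hτ).2 rfl

/-- Induction along a Morse sequence: the lower face `σ` of a regular pair `(σ, τ)` comes after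
the other proper faces of `τ`. -/
theorem forward_induction {P : Finset V → Prop} (hcrit : ∀ ν, W.IsCritical ν → P ν)
    (hup : ∀ τ, W.IsUpperRegular τ → P τ)
    (hlow : ∀ σ τ, W.IsRegularPair σ τ → (∀ ρ ∈ K, ρ ⊂ τ → ρ ≠ σ → P ρ) → P σ)
    (hρ : ρ ∈ K) : P ρ := by
  have key : ∀ j, ∀ ρ ∈ W.cplx j, P ρ := by
    intro j
    induction j using Fin.induction with
    | zero => rw [W.first]; exact fun _ h => h.elim
    | succ i ih =>
      intro ρ hρ
      rcases W.step i with ⟨σ, τ, h⟩ | ⟨ν, h⟩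
      · by_cases hσ : ρ = σ
        · subst hσ
          -- The other proper faces of `τ` lie in the complex containing `τ`, and are not removed
          -- when passing to the previous one.
          refine hlow _ τ ⟨i, h⟩ fun ρ' hρ' hτ hne => ih _ (h.mem_iff.2 ⟨?_, hne, hτ.ne⟩)
          exact mem_of_subset h.1.2.1 hτ.1 (nonempty_of_mem hρ')
        · by_cases hτ : ρ = τ
          · exact hτ ▸ hup _ ⟨σ, i, h⟩
          · exact ih _ (h.mem_iff.2 ⟨hρ, hσ, hτ⟩)
      · by_cases hν : ρ = ν
        · exact hν ▸ hcrit _ ⟨i, h⟩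
        · exact ih _ (h.mem_iff.2 ⟨hρ, hν⟩)
  exact key (Fin.last _) ρ (by rwa [W.last])

/-- Backward induction along a Morse sequence: the upper face `τ` of a regular pair `(σ, τ)` comes
before the other faces strictly containing `σ`. -/
theorem backward_induction {P : Finset V → Prop} (hcrit : ∀ ν, W.IsCritical ν → P ν)
    (hlow : ∀ σ, W.IsLowerRegular σ → P σ)
    (hup : ∀ σ τ, W.IsRegularPair σ τ → (∀ ρ ∈ K, σ ⊂ ρ → ρ ≠ τ → P ρ) → P τ)
    (hρ : ρ ∈ K) : P ρ := by
  have key : ∀ j, ∀ ρ ∈ K, ρ ∉ W.cplx j → P ρ := by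
    intro j
    induction j using Fin.reverseInduction with
    | last => rw [W.last]; exact fun _ h h' => absurd h h'
    | cast i ih =>
      intro ρ hρ hρi
      by_cases hmem : ρ ∈ W.cplx i.succ
      · rcases W.step i with ⟨σ, τ, h⟩ | ⟨ν, h⟩
        · rw [h.mem_iff] at hρi
          by_cases hσ : ρ = σ
          · exact hσ ▸ hlow _ ⟨τ, i, h⟩
          · obtain rfl : ρ = τ := by tauto
            -- By freeness, a face strictly containing `σ` other than the upper one is not yet
            -- present, so it is added at a later step.
            exact hup σ ρ ⟨i, h⟩ fun ρ' hρ' hs hne =>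
              ih _ hρ' fun hm => hne ((h.1.2.2 _ hm).1 hs)
        · rw [h.mem_iff] at hρi
          obtain rfl : ρ = ν := by tauto
          exact hcrit _ ⟨i, h⟩
      · exact ih _ hρ hmem
  refine key 0 ρ hρ ?_
  rw [W.first]
  exact fun h => h.elim

end MorseSequence

end Combinatorics

/-! ### Boundary and coboundary: transposition and vanishing squares -/

section Operators

variable {V : Type*} {K : PreAbstractSimplicialComplex V} [Finite K]

open scoped Classical in
theorem boundary_single_apply (p q : ℤ) (σ : Simplex K p) (τ : Simplex K q) :
    boundary K p q (Finsupp.single σ 1) τ = if q = p - 1 ∧ τ.1 ⊂ σ.1 then 1 else 0 := by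
  simp [boundary, chainOf, Set.indicator_apply]

open scoped Classical in
theorem coboundary_single_apply (p q : ℤ) (σ : Simplex K p) (τ : Simplex K q) :
    coboundary K p q (Finsupp.single σ 1) τ = if q = p + 1 ∧ σ.1 ⊂ τ.1 then 1 else 0 := by
  simp [coboundary, chainOf, Set.indicator_apply]

theorem boundary_eq_zero {p q : ℤ} (h : q ≠ p - 1) : boundary K p q = 0 := by
  ext σ τ
  simp [boundary_single_apply, h]

theorem coboundary_eq_zero {p q : ℤ} (h : q ≠ p + 1) : coboundary K p q = 0 := by
  ext σ τ
  simp [coboundary_single_apply, h]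

theorem coboundary_single_apply_eq (p q : ℤ) (σ : Simplex K p) (τ : Simplex K q) :
    coboundary K p q (Finsupp.single σ 1) τ = boundary K q p (Finsupp.single τ 1) σ := by
  classical
  rw [boundary_single_apply, coboundary_single_apply]
  congr 2
  rw [eq_comm, eq_sub_iff_add_eq, eq_comm, eq_comm (a := q)]

/-- If `D` and `D'` have transposed matrices, then `D'` is adjoint to `D`. -/
theorem linearCombination_transpose {R α β : Type*} [CommSemiring R]
    {D : (α →₀ R) →ₗ[R] (β →₀ R)} {D' : (β →₀ R) →ₗ[R] (α →₀ R)}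
    (h : ∀ a b, D' (Finsupp.single b 1) a = D (Finsupp.single a 1) b) (x : α →₀ R) (b : β) :
    Finsupp.linearCombination R x (D' (Finsupp.single b 1)) = D x b := by
  induction x using Finsupp.induction_linear with
  | zero => simp
  | add x y hx hy =>
    simp only [Finsupp.linearCombination_apply, Finsupp.coe_add, Pi.add_apply, smul_add,
      map_add] at hx hy ⊢
    rw [Finsupp.sum_add, hx, hy]
  | single a r =>
    rw [← mul_one r, ← smul_eq_mul, ← Finsupp.smul_single, map_smul, Finsupp.smul_apply, ← h,
      Finsupp.linearCombination_apply, Finsupp.sum, Finset.sum_eq_single a]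
    · simp [mul_comm]
    · intro c _ hc
      simp [hc.symm]
    · simp +contextual

/-- The coefficient counts the `q`-simplices `ρ` strictly between `τ` and `σ`. The fixed-point-free
involution `ρ ↦ τ ∪ (σ \ ρ)` pairs them, and each pair contributes zero modulo 2. -/
theorem boundary_boundary_single_apply (p q r : ℤ) (σ : Simplex K p) (τ : Simplex K r) :
    boundary K q r (boundary K p q (Finsupp.single σ 1)) τ = 0 := by
  classical
  rw [← linearCombination_transpose (fun a b => coboundary_single_apply_eq r q b a),
    Finsupp.linearCombination_apply, Finsupp.sum]
  set s := (coboundary K r q (Finsupp.single τ 1)).support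
  have hs : ∀ ρ : Simplex K q, ρ ∈ s ↔ q = r + 1 ∧ τ.1 ⊂ ρ.1 := by
    intro ρ
    simp [s, coboundary_single_apply]
  have hc : ∀ ρ ∈ s, coboundary K r q (Finsupp.single τ 1) ρ = 1 := by
    intro ρ hρ
    rw [coboundary_single_apply, if_pos ((hs ρ).1 hρ)]
  by_cases hpq : q = p - 1
  swap
  · exact Finset.sum_eq_zero fun ρ _ => by simp [boundary_single_apply, hpq]
  simp only [boundary_single_apply, smul_eq_mul]
  rw [Finset.sum_congr rfl fun ρ hρ => by rw [hc ρ hρ, one_mul], ← Finset.sum_filter]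
  have hT : ∀ ρ ∈ s.filter (fun ρ => q = p - 1 ∧ ρ.1 ⊂ σ.1),
      q = r + 1 ∧ τ.1 ⊂ ρ.1 ∧ ρ.1 ⊂ σ.1 := by
    intro ρ hρ
    rw [Finset.mem_filter, hs] at hρ
    tauto
  have hcard : ∀ ρ ∈ s.filter (fun ρ => q = p - 1 ∧ ρ.1 ⊂ σ.1),
      (((τ.1 ∪ σ.1 \ ρ.1).card : ℕ) : ℤ) = q + 1 := by
    intro ρ hρ
    obtain ⟨hq, h1, h2⟩ := hT ρ hρ
    rw [Finset.card_union_of_disjoint (Finset.disjoint_of_subset_left h1.1 Finset.disjoint_sdiff)]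
    have := Finset.card_sdiff_add_card_eq_card h2.1
    have h3 := σ.2.2
    have h4 := ρ.2.2
    have h5 := τ.2.2
    push_cast
    omega
  have hsub : ∀ ρ ∈ s.filter (fun ρ => q = p - 1 ∧ ρ.1 ⊂ σ.1), τ.1 ∪ σ.1 \ ρ.1 ⊆ σ.1 := by
    intro ρ hρ
    obtain ⟨hq, h1, h2⟩ := hT ρ hρ
    exact Finset.union_subset (h1.1.trans h2.1) Finset.sdiff_subset
  have hne : ∀ ρ ∈ s.filter (fun ρ => q = p - 1 ∧ ρ.1 ⊂ σ.1), τ.1 ∪ σ.1 \ ρ.1 ≠ ρ.1 := by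
    intro ρ hρ he
    obtain ⟨a, ha, haρ⟩ := Finset.exists_of_ssubset (hT ρ hρ).2.2
    exact haρ (he ▸ Finset.mem_union_right _ (Finset.mem_sdiff.2 ⟨ha, haρ⟩))
  refine Finset.sum_involution
    (fun ρ hρ => ⟨τ.1 ∪ σ.1 \ ρ.1, mem_of_subset σ.2.1 (hsub ρ hρ)
      ((nonempty_of_mem τ.2.1).mono Finset.subset_union_left), hcard ρ hρ⟩) ?_ ?_ ?_ ?_
  · intro ρ hρ
    exact CharTwo.add_self_eq_zero _
  · intro ρ hρ _ he
    exact hne ρ hρ (congrArg Subtype.val he)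
  · intro ρ hρ
    have hq := (hT ρ hρ).1
    rw [Finset.mem_filter, hs]
    refine ⟨⟨hq, Finset.subset_union_left.ssubset_of_ne fun he => ?_⟩, hpq,
      (hsub ρ hρ).ssubset_of_ne fun he => ?_⟩
    · have h1 := hcard ρ hρ
      rw [← he, τ.2.2] at h1
      omega
    · have h1 := hcard ρ hρ
      rw [he, σ.2.2] at h1
      omega
  · intro ρ hρ
    obtain ⟨hq, h1, h2⟩ := hT ρ hρ
    ext a
    have h1 := @h1.1 a
    have h2 := @h2.1 a
    simp only [Finset.mem_union, Finset.mem_sdiff]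
    tauto

theorem boundary_comp_boundary (p q r : ℤ) : boundary K q r ∘ₗ boundary K p q = 0 := by
  ext σ τ
  simpa using boundary_boundary_single_apply p q r σ τ

theorem coboundary_comp_coboundary (p q r : ℤ) : coboundary K q r ∘ₗ coboundary K p q = 0 := by
  classical
  ext σ τ
  -- Transposition turns both composites into the same sum over intermediate simplices.
  have h := boundary_boundary_single_apply r q p τ σ
  rw [← linearCombination_transpose (fun a b => coboundary_single_apply_eq p q b a)] at h
  have h' := linearCombination_transpose (fun a b => (coboundary_single_apply_eq q r a b).symm)
    (coboundary K p q (Finsupp.single σ 1)) τ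
  simp only [LinearMap.comp_apply, Finsupp.lsingle_apply, LinearMap.zero_apply,
    Finsupp.zero_apply]
  rw [← h', ← h]
  simp only [Finsupp.linearCombination_apply, smul_eq_mul]
  rw [Finsupp.sum_of_support_subset _ (Finset.subset_union_left (s₂ :=
      (coboundary K p q (Finsupp.single σ 1)).support)) _ (by simp),
    Finsupp.sum_of_support_subset _ (Finset.subset_union_right (s₁ :=
      (boundary K r q (Finsupp.single τ 1)).support)) _ (by simp)]
  exact Finset.sum_congr rfl fun _ _ => mul_comm _ _

end Operators

/-! ### Isomorphisms induced in homology -/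

section HomologyEquiv

variable {R A B C A' B' C' : Type*} [Ring R]
  [AddCommGroup A] [Module R A] [AddCommGroup B] [Module R B] [AddCommGroup C] [Module R C]
  [AddCommGroup A'] [Module R A'] [AddCommGroup B'] [Module R B'] [AddCommGroup C'] [Module R C']
  {f : A →ₗ[R] B} {g : B →ₗ[R] C} {f' : A' →ₗ[R] B'} {g' : B' →ₗ[R] C'}

/-- A map of composable pairs induces a map in homology. -/
theorem exists_isInducedBy (α : A →ₗ[R] A') (φ : B →ₗ[R] B') (γ : C →ₗ[R] C')
    (hα : f' ∘ₗ α = φ ∘ₗ f) (hγ : g' ∘ₗ φ = γ ∘ₗ g) :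
    ∃ e : Homology f g →ₗ[R] Homology f' g', IsInducedBy e φ := by
  have hker : ∀ z ∈ LinearMap.ker g, φ z ∈ LinearMap.ker g' := by
    intro z hz
    have := LinearMap.congr_fun hγ z
    simp only [LinearMap.comp_apply] at this
    rw [LinearMap.mem_ker] at hz ⊢
    rw [this, hz, map_zero]
  refine ⟨Submodule.mapQ _ _ (φ.restrict hker) ?_, fun z => ⟨hker z z.2, rfl⟩⟩
  rintro z ⟨a, ha⟩
  refine ⟨α a, ?_⟩
  have := LinearMap.congr_fun hα a
  simp only [LinearMap.comp_apply] at this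
  rw [this, ha]
  rfl

/-- No chain homotopy is needed: it is enough that `ψ (φ z) - z` is a boundary for each cycle `z`.
-/
theorem exists_homology_equiv (α : A →ₗ[R] A') (φ : B →ₗ[R] B') (γ : C →ₗ[R] C')
    (α' : A' →ₗ[R] A) (ψ : B' →ₗ[R] B) (γ' : C' →ₗ[R] C)
    (hα : f' ∘ₗ α = φ ∘ₗ f) (hγ : g' ∘ₗ φ = γ ∘ₗ g)
    (hα' : f ∘ₗ α' = ψ ∘ₗ f') (hγ' : g ∘ₗ ψ = γ' ∘ₗ g')
    (hφψ : ∀ w, φ (ψ w) = w) (hψφ : ∀ z, g z = 0 → ψ (φ z) - z ∈ LinearMap.range f) :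
    ∃ e : Homology f g ≃ₗ[R] Homology f' g',
      IsInducedBy e.toLinearMap φ ∧ IsInducedBy e.symm.toLinearMap ψ := by
  obtain ⟨e, he⟩ := exists_isInducedBy α φ γ hα hγ
  obtain ⟨e', he'⟩ := exists_isInducedBy α' ψ γ' hα' hγ'
  refine ⟨LinearEquiv.ofLinearMap e e' ?_ ?_, he, he'⟩
  · ext w
    obtain ⟨h, h1⟩ := he' w
    obtain ⟨h', h2⟩ := he ⟨ψ w, h⟩
    change e (e' (homologyClass f' g' w)) = homologyClass f' g' w
    rw [h1, h2]
    congr 1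
    exact Subtype.ext (hφψ w)
  · ext z
    obtain ⟨h, h1⟩ := he z
    obtain ⟨h', h2⟩ := he' ⟨φ z, h⟩
    change e' (e (homologyClass f g z)) = homologyClass f g z
    rw [h1, h2]
    exact (Submodule.Quotient.eq _).2 (hψφ z z.2)

end HomologyEquiv

/-! ### Reference maps, generators and transposes -/

section Frames

open MorseSequence

variable {V : Type*} {K : PreAbstractSimplicialComplex V} {W : MorseSequence K}

/-- The common part of the definitions of reference maps (`D` is the boundary and `A` the set of
upper regular faces) and coreference maps (`D` is the coboundary, `A` the lower regular faces). -/
structure IsReferenceFor (A : Finset V → Prop) (D : ∀ p q, Chain K p →ₗ[ZMod 2] Chain K q)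
    (Υ : W.Frame) : Prop where
  critical : ∀ (p : ℤ) (ν : Simplex K p), W.IsCritical ν.1 →
    (Υ p ν : Chain K p) = Finsupp.single ν 1
  vanish : ∀ (p : ℤ) (τ : Simplex K p), A τ.1 → Υ p τ = 0
  vanish_map : ∀ (p q : ℤ) (τ : Simplex K p), A τ.1 →
    frameMap Υ q (D p q (Finsupp.single τ 1)) = 0

/-- The chains that generate `K[p]`: the critical faces, the faces in `A`, and the images of the
`n`-dimensional faces in `A`. -/
def generators (W : MorseSequence K) (A : Finset V → Prop)
    (D : ∀ p q, Chain K p →ₗ[ZMod 2] Chain K q) (n p : ℤ) : Set (Chain K p) :=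
  {x | (∃ ν : Simplex K p, W.IsCritical ν.1 ∧ x = Finsupp.single ν 1) ∨
    (∃ τ : Simplex K p, A τ.1 ∧ x = Finsupp.single τ 1) ∨
    ∃ τ : Simplex K n, A τ.1 ∧ x = D n p (Finsupp.single τ 1)}

variable {A B : Finset V → Prop} {D D' : ∀ p q, Chain K p →ₗ[ZMod 2] Chain K q}
  {Υ Υ' : W.Frame} {n p q r : ℤ}

@[simp]
theorem frameMap_single (p : ℤ) (σ : Simplex K p) : frameMap Υ p (Finsupp.single σ 1) = Υ p σ := by
  simp [frameMap]

/-- The axioms prescribe the value on every generator. -/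
theorem IsReferenceFor.eq (hspan : ⊤ ≤ Submodule.span (ZMod 2) (generators W A D n p))
    (h : IsReferenceFor A D Υ) (h' : IsReferenceFor A D Υ') : Υ p = Υ' p := by
  have : frameMap Υ p = frameMap Υ' p := by
    refine LinearMap.ext_on (eq_top_iff.2 hspan) ?_
    rintro _ (⟨ν, hν, rfl⟩ | ⟨τ, hτ, rfl⟩ | ⟨τ, hτ, rfl⟩)
    · simp only [frameMap_single]
      exact Subtype.ext ((h.critical p ν hν).trans (h'.critical p ν hν).symm)
    · simp [h.vanish p τ hτ, h'.vanish p τ hτ]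
    · rw [h.vanish_map n p τ hτ, h'.vanish_map n p τ hτ]
  funext σ
  simpa using LinearMap.congr_fun this (Finsupp.single σ 1)

/-- The map `p ↦ q` of the critical complex commutes with the reference map. -/
theorem IsReferenceFor.frameMap_comm
    (hspan : ⊤ ≤ Submodule.span (ZMod 2) (generators W A D n p))
    (h : IsReferenceFor A D Υ) (hD : D p q ∘ₗ D n p = 0) (x : Chain K p) :
    frameMap Υ q (D p q (frameMap Υ p x)) = frameMap Υ q (D p q x) := by
  suffices frameMap Υ q ∘ₗ D p q ∘ₗ (W.criticalChains p).subtype ∘ₗ frameMap Υ p =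
      frameMap Υ q ∘ₗ D p q from LinearMap.congr_fun this x
  -- The frame fixes critical faces; both sides vanish on faces in `A`; on the image of such a face,
  -- the left side vanishes by `vanish_map` and the right side by `hD`.
  refine LinearMap.ext_on (eq_top_iff.2 hspan) ?_
  rintro _ (⟨ν, hν, rfl⟩ | ⟨τ, hτ, rfl⟩ | ⟨τ, hτ, rfl⟩)
  · simp [h.critical p ν hν]
  · simp [h.vanish p τ hτ, h.vanish_map p q τ hτ]
  · have := LinearMap.congr_fun hD (Finsupp.single τ 1)
    simp only [LinearMap.comp_apply, LinearMap.zero_apply] at this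
    simp [h.vanish_map n p τ hτ, this]

/-- A chain orthogonal to the generators is zero. -/
theorem eq_zero_of_orthogonal (hspan : ⊤ ≤ Submodule.span (ZMod 2) (generators W B D' q p))
    (hT : ∀ (σ : Simplex K p) (τ : Simplex K q),
      D' q p (Finsupp.single τ 1) σ = D p q (Finsupp.single σ 1) τ)
    {x : Chain K p} (hcrit : ∀ ν : Simplex K p, W.IsCritical ν.1 → x ν = 0)
    (hB : ∀ σ : Simplex K p, B σ.1 → x σ = 0) (hDB : ∀ σ : Simplex K q, B σ.1 → D p q x σ = 0) :
    x = 0 := by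
  -- This is the functional `y ↦ ⟨x, y⟩`; its value on the `D'`-image of `τ` is the coefficient of
  -- `D p q x` at `τ`.
  have : Finsupp.linearCombination (ZMod 2) x = 0 := by
    refine LinearMap.ext_on (eq_top_iff.2 hspan) ?_
    rintro _ (⟨ν, hν, rfl⟩ | ⟨τ, hτ, rfl⟩ | ⟨τ, hτ, rfl⟩)
    · simp [hcrit ν hν]
    · simp [hB τ hτ]
    · rw [linearCombination_transpose hT, hDB τ hτ, LinearMap.zero_apply]
  ext σ
  simpa using LinearMap.congr_fun this (Finsupp.single σ 1)

/-- On a chain without faces in `B`, the reference map is the projection to the critical part. -/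
theorem IsReferenceFor.frameMap_apply (h : IsReferenceFor A D Υ)
    (hcover : ∀ σ : Simplex K p, W.IsCritical σ.1 ∨ A σ.1 ∨ B σ.1)
    {x : Chain K p} (hx : ∀ σ : Simplex K p, B σ.1 → x σ = 0) (ν : Simplex K p)
    (hν : W.IsCritical ν.1) : (frameMap Υ p x : Chain K p) ν = x ν := by
  classical
  rw [frameMap, Finsupp.linearCombination_apply, Finsupp.sum, AddSubmonoidClass.coe_finsetSum,
    Finsupp.finsetSum_apply]
  rw [Finset.sum_eq_single ν]
  · simp [h.critical p ν hν]
  · intro σ _ hne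
    rcases hcover σ with hσ | hσ | hσ
    · simp [h.critical p σ hσ, hne.symm]
    · simp [h.vanish p σ hσ]
    · simp [hx σ hσ]
  · intro hν
    simp [Finsupp.notMem_support_iff.1 hν]

/-- A cycle in the kernel of the reference map is a boundary. -/
theorem IsReferenceFor.mem_range (h : IsReferenceFor A D Υ)
    (hA : ∀ ν : Finset V, W.IsCritical ν → ¬ A ν) (hAB : ∀ ν : Finset V, B ν → ¬ A ν)
    (hT : ∀ (σ : Simplex K p) (τ : Simplex K q),
      D' q p (Finsupp.single τ 1) σ = D p q (Finsupp.single σ 1) τ)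
    (hspan : ⊤ ≤ Submodule.span (ZMod 2) (generators W A D n p))
    (hspan' : ⊤ ≤ Submodule.span (ZMod 2) (generators W B D' q p))
    (hD : D p q ∘ₗ D n p = 0) {x : Chain K p} (hx : D p q x = 0) (hx' : frameMap Υ p x = 0) :
    x ∈ LinearMap.range (D n p) := by
  -- Splitting along the generators: a critical part, a part `u` supported on `A`, and an image
  -- under `D`.
  have key : ∀ x : Chain K p, ∃ u v, (∀ σ : Simplex K p, ¬ A σ.1 → u σ = 0) ∧
      x = frameMap Υ p x + u + D n p v := by
    intro x
    induction hspan (Submodule.mem_top (x := x)) using Submodule.span_induction with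
    | zero => exact ⟨0, 0, by simp⟩
    | add x y _ _ hx hy =>
      obtain ⟨u, v, hu, hx⟩ := hx
      obtain ⟨u', v', hu', hy⟩ := hy
      refine ⟨u + u', v + v', fun σ hσ => by simp [hu σ hσ, hu' σ hσ], ?_⟩
      nth_rw 1 [hx, hy]
      simp only [map_add, Submodule.coe_add]
      abel
    | smul a x _ hx =>
      obtain ⟨u, v, hu, hx⟩ := hx
      refine ⟨a • u, a • v, fun σ hσ => by simp [hu σ hσ], ?_⟩
      nth_rw 1 [hx]
      simp only [map_smul, smul_add, Submodule.coe_smul]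
    | mem x hx =>
      rcases hx with ⟨ν, hν, rfl⟩ | ⟨τ, hτ, rfl⟩ | ⟨τ, hτ, rfl⟩
      · exact ⟨0, 0, by simp, by simp [h.critical p ν hν]⟩
      · refine ⟨Finsupp.single τ 1, 0, fun σ hσ => ?_, by simp [h.vanish p τ hτ]⟩
        exact Finsupp.single_eq_of_ne fun he => hσ (he ▸ hτ)
      · exact ⟨0, Finsupp.single τ 1, by simp, by simp [h.vanish_map n p τ hτ]⟩
  obtain ⟨u, v, hu, hxuv⟩ := key x
  rw [hx', ZeroMemClass.coe_zero, zero_add] at hxuv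
  have hDv := LinearMap.congr_fun hD v
  simp only [LinearMap.comp_apply, LinearMap.zero_apply] at hDv
  have hDu : D p q u = 0 := by
    have := hx
    rwa [hxuv, map_add, hDv, add_zero] at this
  -- Being supported on `A`, the chain `u` vanishes on critical faces and on `B`; as `D p q u = 0`,
  -- it is orthogonal to all dual generators.
  have : u = 0 := eq_zero_of_orthogonal hspan' hT (fun ν hν => hu ν (hA _ hν))
    (fun σ hσ => hu σ (hAB _ hσ)) (by simp [hDu])
  exact ⟨v, by rw [hxuv, this, zero_add]⟩

variable [Finite K]

/-- The transpose map is adjoint to the linear extension of the frame. -/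
theorem linearCombination_transposeMap (κ : W.criticalChains p) (x : Chain K p) :
    Finsupp.linearCombination (ZMod 2) (transposeMap Υ p κ) x =
      Finsupp.linearCombination (ZMod 2) (κ : Chain K p) (frameMap Υ p x : Chain K p) := by
  obtain ⟨κ, hκ⟩ := κ
  suffices ∀ σ : Simplex K p, Finsupp.linearCombination (ZMod 2)
      (fun κ : Simplex K p => chainOf {ν : Simplex K p | κ ∈ (Υ p ν : Chain K p).support}) κ σ =
      Finsupp.linearCombination (ZMod 2) κ (Υ p σ : Chain K p) by
    induction x using Finsupp.induction_linear with
    | zero => simp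
    | add x y hx hy => rw [map_add, hx, hy, map_add, Submodule.coe_add, map_add]
    | single σ a =>
      rw [← mul_one a, ← smul_eq_mul, ← Finsupp.smul_single, map_smul, map_smul, frameMap_single,
        Submodule.coe_smul, map_smul]
      simp only [Finsupp.linearCombination_single, one_smul]
      exact congrArg (a • ·) (this σ)
  intro σ
  classical
  have key : ∀ ν, (chainOf {μ : Simplex K p | ν ∈ (Υ p μ : Chain K p).support} : Chain K p) σ =
      (Υ p σ : Chain K p) ν := by
    intro ν
    -- Modulo 2 a coefficient is the indicator of its being nonzero, so the supports record the
    -- whole matrix of the frame.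
    have h2 : ∀ a : ZMod 2, (if a = 0 then 0 else 1) = a := by decide
    simpa [chainOf, Set.indicator_apply] using h2 _
  have := Fintype.ofFinite (Simplex K p)
  rw [Finsupp.linearCombination_apply, Finsupp.linearCombination_apply, Finsupp.sum_apply,
    Finsupp.sum_fintype _ _ (by simp), Finsupp.sum_fintype _ _ (by simp)]
  refine Finset.sum_congr rfl fun ν _ => ?_
  rw [Finsupp.smul_apply, key, smul_eq_mul, smul_eq_mul, mul_comm]

theorem transposeMap_apply (κ : W.criticalChains p) (σ : Simplex K p) :
    transposeMap Υ p κ σ =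
      Finsupp.linearCombination (ZMod 2) (κ : Chain K p) (Υ p σ : Chain K p) := by
  simpa using linearCombination_transposeMap κ (Finsupp.single σ 1) (Υ := Υ)

theorem IsReferenceFor.transposeMap_apply_critical (h' : IsReferenceFor B D' Υ')
    (κ : W.criticalChains p) {ν : Simplex K p} (hν : W.IsCritical ν.1) :
    transposeMap Υ' p κ ν = (κ : Chain K p) ν := by
  simp [transposeMap_apply, h'.critical p ν hν]

theorem IsReferenceFor.transposeMap_apply_eq_zero (h' : IsReferenceFor B D' Υ')
    (κ : W.criticalChains p) {σ : Simplex K p} (hσ : B σ.1) : transposeMap Υ' p κ σ = 0 := by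
  simp [transposeMap_apply, h'.vanish p σ hσ]

/-- By adjunction the coefficient is the pairing of `κ` with the value of `Υ'` on the `D'`-image of
`σ`, which is zero. -/
theorem IsReferenceFor.map_transposeMap_apply_eq_zero (h' : IsReferenceFor B D' Υ')
    (hT : ∀ (σ : Simplex K p) (τ : Simplex K q),
      D' q p (Finsupp.single τ 1) σ = D p q (Finsupp.single σ 1) τ)
    (κ : W.criticalChains p) {σ : Simplex K q} (hσ : B σ.1) :
    D p q (transposeMap Υ' p κ) σ = 0 := by
  rw [← linearCombination_transpose hT, linearCombination_transposeMap, h'.vanish_map q p σ hσ]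
  simp

/-- The transposed chain has no faces in `B`, so the frame only reads its critical coefficients,
which are those of `κ`. -/
theorem IsReferenceFor.frameMap_transposeMap (h : IsReferenceFor A D Υ)
    (h' : IsReferenceFor B D' Υ') (hcover : ∀ σ : Simplex K p, W.IsCritical σ.1 ∨ A σ.1 ∨ B σ.1)
    (κ : W.criticalChains p) :
    frameMap Υ p (transposeMap Υ' p κ) = κ := by
  refine Subtype.ext (Finsupp.ext fun ν => ?_)
  by_cases hν : W.IsCritical ν.1
  · rw [h.frameMap_apply hcover (fun σ hσ => h'.transposeMap_apply_eq_zero κ hσ) ν hν,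
      h'.transposeMap_apply_critical κ hν]
  · rw [(Finsupp.mem_supported' (ZMod 2) _).1 (frameMap Υ p (transposeMap Υ' p κ)).2 ν hν,
      (Finsupp.mem_supported' (ZMod 2) _).1 κ.2 ν hν]

/-- The map `p ↦ q` of the critical complex commutes with the transpose maps. -/
theorem IsReferenceFor.map_transposeMap (h : IsReferenceFor A D Υ) (h' : IsReferenceFor B D' Υ')
    (hcover : ∀ (p : ℤ) (σ : Simplex K p), W.IsCritical σ.1 ∨ A σ.1 ∨ B σ.1)
    (hT : ∀ (p q : ℤ) (σ : Simplex K p) (τ : Simplex K q),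
      D' q p (Finsupp.single τ 1) σ = D p q (Finsupp.single σ 1) τ)
    (hspan : ⊤ ≤ Submodule.span (ZMod 2) (generators W A D n p))
    (hspan' : ⊤ ≤ Submodule.span (ZMod 2) (generators W B D' r q))
    (hD : D p q ∘ₗ D n p = 0) (hD' : D q r ∘ₗ D p q = 0) (κ : W.criticalChains p) :
    D p q (transposeMap Υ' p κ) = transposeMap Υ' q (frameMap Υ q (D p q κ)) := by
  rw [← sub_eq_zero]
  have hB : ∀ σ : Simplex K q, B σ.1 → D p q (transposeMap Υ' p κ) σ = 0 :=
    fun σ hσ => h'.map_transposeMap_apply_eq_zero (hT p q) κ hσ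
  -- The two sides agree on critical faces and vanish on `B`, and so do their images under `D q r`
  -- on `B`. The critical coefficients are compared by applying the frame, which turns the transpose
  -- of `κ` back into `κ`.
  refine eq_zero_of_orthogonal hspan' (hT q r) (fun ν hν => ?_) (fun σ hσ => ?_) (fun σ hσ => ?_)
  · rw [Finsupp.sub_apply, h'.transposeMap_apply_critical _ hν,
      ← h.frameMap_apply (hcover q) hB ν hν, ← h.frameMap_comm hspan hD,
      h.frameMap_transposeMap h' (hcover p), sub_self]
  · rw [Finsupp.sub_apply, h'.transposeMap_apply_eq_zero _ hσ, hB σ hσ, sub_self]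
  · have := LinearMap.congr_fun hD' (transposeMap Υ' p κ)
    simp only [LinearMap.comp_apply, LinearMap.zero_apply] at this
    rw [map_sub, this, zero_sub, Finsupp.neg_apply,
      h'.map_transposeMap_apply_eq_zero (hT q r) _ hσ, neg_zero]

/-- The generators indexed by the `p`-simplices form a basis, which allows to prescribe the values
of a reference map. -/
theorem exists_frameMap (Rel : Finset V → Finset V → Prop)
    (hspan : ⊤ ≤ Submodule.span (ZMod 2) (generators W A D n p))
    (hA : ∀ ν : Finset V, W.IsCritical ν → ¬ A ν) (hB : ∀ ν : Finset V, W.IsCritical ν → ¬ B ν)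
    (hAB : ∀ ν : Finset V, B ν → ¬ A ν)
    (hRel : ∀ σ : Simplex K p, B σ.1 → ∃ τ : Simplex K n, Rel σ.1 τ.1)
    (hRel' : ∀ τ : Simplex K n, A τ.1 → ∃ σ : Simplex K p, B σ.1 ∧ Rel σ.1 τ.1)
    (huniq : ∀ σ τ τ', Rel σ τ → Rel σ τ' → τ = τ') :
    ∃ f : Chain K p →ₗ[ZMod 2] W.criticalChains p,
      (∀ ν : Simplex K p, W.IsCritical ν.1 →
        (f (Finsupp.single ν 1) : Chain K p) = Finsupp.single ν 1) ∧
      (∀ τ : Simplex K p, A τ.1 → f (Finsupp.single τ 1) = 0) ∧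
      ∀ τ : Simplex K n, A τ.1 → f (D n p (Finsupp.single τ 1)) = 0 := by
  classical
  have := Fintype.ofFinite (Simplex K p)
  -- In the standard basis, each face in `B` is replaced by the image of its mate.
  have hb : ∀ σ : Simplex K p, ∃ v : Chain K p, (B σ.1 → ∃ τ : Simplex K n, Rel σ.1 τ.1 ∧
      v = D n p (Finsupp.single τ 1)) ∧ (¬ B σ.1 → v = Finsupp.single σ 1) := by
    intro σ
    by_cases hσ : B σ.1
    · obtain ⟨τ, hτ⟩ := hRel σ hσ
      exact ⟨_, fun _ => ⟨τ, hτ, rfl⟩, fun h => absurd hσ h⟩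
    · exact ⟨_, fun h => absurd h hσ, fun _ => rfl⟩
  choose b hb1 hb2 using hb
  have hbτ : ∀ τ : Simplex K n, A τ.1 →
      ∃ σ : Simplex K p, B σ.1 ∧ b σ = D n p (Finsupp.single τ 1) := by
    intro τ hτ
    obtain ⟨σ, hσ, hστ⟩ := hRel' τ hτ
    obtain ⟨τ', hστ', hb'⟩ := hb1 σ hσ
    obtain rfl : τ = τ' := Subtype.ext (huniq _ _ _ hστ hστ')
    exact ⟨σ, hσ, hb'⟩
  have hbspan : ⊤ ≤ Submodule.span (ZMod 2) (Set.range b) := by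
    refine hspan.trans (Submodule.span_mono ?_)
    rintro _ (⟨ν, hν, rfl⟩ | ⟨τ, hτ, rfl⟩ | ⟨τ, hτ, rfl⟩)
    · exact ⟨ν, hb2 ν (hB _ hν)⟩
    · exact ⟨τ, hb2 τ fun h => hAB _ h hτ⟩
    · obtain ⟨σ, -, hσ⟩ := hbτ τ hτ
      exact ⟨σ, hσ⟩
  -- The family is indexed by the `p`-simplices, so spanning already gives a basis.
  let e := basisOfTopLeSpanOfCardEqFinrank b hbspan (by simp)
  have he : ∀ σ, e σ = b σ := fun σ => by simp [e]
  let f : Chain K p →ₗ[ZMod 2] W.criticalChains p := e.constr (ZMod 2) fun σ =>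
    if h : W.IsCritical σ.1 then
      ⟨Finsupp.single σ 1, Finsupp.single_mem_supported (ZMod 2) 1 h⟩ else 0
  have hf : ∀ σ, f (b σ) = if h : W.IsCritical σ.1 then
      ⟨Finsupp.single σ 1, Finsupp.single_mem_supported (ZMod 2) 1 h⟩ else 0 := fun σ => by
    rw [← he]
    exact e.constr_basis _ _ _
  refine ⟨f, fun ν hν => ?_, fun τ hτ => ?_, fun τ hτ => ?_⟩
  · rw [← hb2 ν (hB _ hν), hf, dif_pos hν, hb2 ν (hB _ hν)]
  · rw [← hb2 τ fun h => hAB _ h hτ, hf, dif_neg fun h => hA _ h hτ]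
  · obtain ⟨σ, hσ, h⟩ := hbτ τ hτ
    rw [← h, hf, dif_neg fun h => hB _ h hσ]

end Frames

/-! ### Homology of the critical complex, for boundary and coboundary alike -/

section Matchings

open MorseSequence

variable {V : Type*} {K : PreAbstractSimplicialComplex V} {W : MorseSequence K}

/-- The properties of the regular pairs of a Morse sequence on which the theory of reference maps
rests. They are symmetric in the boundary and the coboundary operator; `D` has degree `-s`. -/
structure IsAcyclicMatching (W : MorseSequence K) (A B : Finset V → Prop)
    (D D' : ∀ p q, Chain K p →ₗ[ZMod 2] Chain K q) (s : ℤ) : Prop where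
  critical_not : ∀ ν, W.IsCritical ν → ¬ A ν
  critical_not' : ∀ ν, W.IsCritical ν → ¬ B ν
  not_of : ∀ ν, B ν → ¬ A ν
  cover : ∀ (p : ℤ) (σ : Simplex K p), W.IsCritical σ.1 ∨ A σ.1 ∨ B σ.1
  transpose : ∀ (p q : ℤ) (σ : Simplex K p) (τ : Simplex K q),
    D' q p (Finsupp.single τ 1) σ = D p q (Finsupp.single σ 1) τ
  comp_eq_zero : ∀ p q r, D q r ∘ₗ D p q = 0
  map_eq_zero : ∀ n p, n ≠ p + s → D n p = 0
  span : ∀ n p, n = p + s → ⊤ ≤ Submodule.span (ZMod 2) (generators W A D n p)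
  span' : ∀ n p, n = p - s → ⊤ ≤ Submodule.span (ZMod 2) (generators W B D' n p)
  exists_mate : ∃ Rel : Finset V → Finset V → Prop, (∀ σ τ τ', Rel σ τ → Rel σ τ' → τ = τ') ∧
    ∀ n p, n = p + s → (∀ σ : Simplex K p, B σ.1 → ∃ τ : Simplex K n, Rel σ.1 τ.1) ∧
      ∀ τ : Simplex K n, A τ.1 → ∃ σ : Simplex K p, B σ.1 ∧ Rel σ.1 τ.1

variable {A B : Finset V → Prop} {D D' : ∀ p q, Chain K p →ₗ[ZMod 2] Chain K q}
  {s : ℤ} {Υ Υ' : W.Frame}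

/-- The differential of the critical complex that is defined by a frame. -/
noncomputable abbrev criticalDifferential
    (D : ∀ p q, Chain K p →ₗ[ZMod 2] Chain K q) (Υ : W.Frame) (p q : ℤ) :
    W.criticalChains p →ₗ[ZMod 2] W.criticalChains q :=
  frameMap Υ q ∘ₗ D p q ∘ₗ (W.criticalChains p).subtype

theorem IsAcyclicMatching.critical_comp (M : IsAcyclicMatching W A B D D' s)
    (h : IsReferenceFor A D Υ) (n p q : ℤ) :
    criticalDifferential D Υ p q ∘ₗ criticalDifferential D Υ n p = 0 := by
  refine LinearMap.ext fun κ => ?_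
  have := LinearMap.congr_fun (M.comp_eq_zero n p q) κ
  simp only [LinearMap.comp_apply, LinearMap.zero_apply] at this
  simp [h.frameMap_comm (M.span _ p rfl) (M.comp_eq_zero _ p q), this]

theorem IsAcyclicMatching.critical_comp_frameMap (M : IsAcyclicMatching W A B D D' s)
    (h : IsReferenceFor A D Υ) (p q : ℤ) :
    criticalDifferential D Υ p q ∘ₗ frameMap Υ p = frameMap Υ q ∘ₗ D p q := by
  refine LinearMap.ext fun x => ?_
  exact h.frameMap_comm (M.span _ p rfl) (M.comp_eq_zero _ p q) x

variable [Finite K]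

theorem IsAcyclicMatching.existsUnique (M : IsAcyclicMatching W A B D D' s) :
    ∃! Υ : W.Frame, IsReferenceFor A D Υ := by
  obtain ⟨Rel, huniq, hRel⟩ := M.exists_mate
  choose f hf using fun p => exists_frameMap Rel (M.span (p + s) p rfl) M.critical_not
    M.critical_not' M.not_of (hRel _ p rfl).1 (hRel _ p rfl).2 huniq
  have hfΥ : ∀ p, frameMap (W := W) (fun p σ => f p (Finsupp.single σ 1)) p = f p := by
    intro p
    ext σ : 2
    simp
  refine ⟨fun p σ => f p (Finsupp.single σ 1), ⟨fun p => (hf p).1, fun p => (hf p).2.1, ?_⟩,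
    fun Υ hΥ => funext fun p => hΥ.eq (M.span _ p rfl) ⟨fun p => (hf p).1, fun p => (hf p).2.1, ?_⟩⟩
  -- Only the degree `p = q + s` carries a condition; elsewhere `D p q` is zero.
  all_goals
    intro p q τ hτ
    rw [hfΥ]
    by_cases h : p = q + s
    · subst h
      exact (hf q).2.2 τ hτ
    · rw [M.map_eq_zero p q h, LinearMap.zero_apply, map_zero]

theorem IsAcyclicMatching.comp_transposeMap (M : IsAcyclicMatching W A B D D' s)
    (h : IsReferenceFor A D Υ) (h' : IsReferenceFor B D' Υ') (p q : ℤ) :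
    D p q ∘ₗ transposeMap Υ' p = transposeMap Υ' q ∘ₗ criticalDifferential D Υ p q := by
  refine LinearMap.ext fun κ => ?_
  exact h.map_transposeMap h' M.cover M.transpose (M.span _ p rfl) (M.span' _ q rfl)
    (M.comp_eq_zero _ _ _) (M.comp_eq_zero _ _ _) κ

/-- One composite is the identity on chains. The other moves a cycle by a cycle in the kernel of the
frame, hence by a boundary. -/
theorem IsAcyclicMatching.exists_homology_equiv (M : IsAcyclicMatching W A B D D' s)
    (h : IsReferenceFor A D Υ) (h' : IsReferenceFor B D' Υ') {n p q : ℤ} (hn : n = p + s)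
    (hq : q = p - s) :
    ∃ e : Homology (D n p) (D p q) ≃ₗ[ZMod 2]
        Homology (criticalDifferential D Υ n p) (criticalDifferential D Υ p q),
      IsInducedBy e.toLinearMap (frameMap Υ p) ∧
        IsInducedBy e.symm.toLinearMap (transposeMap Υ' p) := by
  have hid := h.frameMap_transposeMap h' (M.cover p)
  refine MorseSeq.exists_homology_equiv (frameMap Υ n) (frameMap Υ p) (frameMap Υ q)
    (transposeMap Υ' n) (transposeMap Υ' p) (transposeMap Υ' q)
    (M.critical_comp_frameMap h n p) (M.critical_comp_frameMap h p q)
    (M.comp_transposeMap h h' n p) (M.comp_transposeMap h h' p q) hid fun z hz => ?_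
  refine h.mem_range M.critical_not M.not_of (M.transpose p q) (M.span n p hn) (M.span' q p hq)
    (M.comp_eq_zero n p q) ?_ ?_
  · have h1 : D p q (transposeMap Υ' p (frameMap Υ p z)) =
        transposeMap Υ' q (criticalDifferential D Υ p q (frameMap Υ p z)) :=
      LinearMap.congr_fun (M.comp_transposeMap h h' p q) (frameMap Υ p z)
    have h2 : criticalDifferential D Υ p q (frameMap Υ p z) = frameMap Υ q (D p q z) :=
      LinearMap.congr_fun (M.critical_comp_frameMap h p q) z
    rw [map_sub, h1, h2, hz, map_zero, map_zero, sub_zero]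
  · rw [map_sub, hid, sub_self]

end Matchings

/-! ### Morse sequences satisfy the matching axioms -/

section Regular

open MorseSequence

variable {V : Type*} {K : PreAbstractSimplicialComplex V} {W : MorseSequence K}

theorem mem_of_forall_single_mem {p : ℤ} {N : Submodule (ZMod 2) (Chain K p)} {x : Chain K p}
    (h : ∀ σ, x σ ≠ 0 → Finsupp.single σ 1 ∈ N) : x ∈ N := by
  rw [← Finsupp.sum_single x]
  refine Submodule.sum_mem _ fun σ hσ => ?_
  rw [← mul_one (x σ), ← smul_eq_mul, ← Finsupp.smul_single]
  exact N.smul_mem _ (h σ (Finsupp.mem_support_iff.1 hσ))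

theorem MorseSequence.isCritical_or {ρ : Finset V} (hρ : ρ ∈ K) :
    W.IsCritical ρ ∨ W.IsUpperRegular ρ ∨ W.IsLowerRegular ρ :=
  forward_induction (P := fun ρ => W.IsCritical ρ ∨ W.IsUpperRegular ρ ∨ W.IsLowerRegular ρ)
    (fun _ => Or.inl) (fun _ h => Or.inr (Or.inl h))
    (fun _ τ h _ => Or.inr (Or.inr ⟨τ, h⟩)) hρ

variable [Finite K]

/-- For a pair `(σ, τ)`, write `σ = ∂τ - (∂τ - σ)`: the first term is a generator, and the other
faces in `∂τ` are covered by the forward induction. -/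
theorem span_generators_boundary {n p : ℤ} (hn : n = p + 1) :
    ⊤ ≤ Submodule.span (ZMod 2) (generators W W.IsUpperRegular (boundary K) n p) := by
  classical
  intro x _
  refine mem_of_forall_single_mem fun σ _ => ?_
  -- The induction runs over faces of all dimensions; those not of dimension `p` satisfy the
  -- statement vacuously.
  suffices ∀ ρ ∈ K, ∀ σ : Simplex K p, σ.1 = ρ → Finsupp.single σ 1 ∈
      Submodule.span (ZMod 2) (generators W W.IsUpperRegular (boundary K) n p) from
    this σ.1 σ.2.1 σ rfl
  intro ρ hρ
  refine forward_induction (W := W) (P := fun ρ =>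
      ∀ σ : Simplex K p, σ.1 = ρ → Finsupp.single σ 1 ∈
      Submodule.span (ZMod 2) (generators W W.IsUpperRegular (boundary K) n p)) ?_ ?_ ?_ hρ
  · rintro _ hν σ rfl
    exact Submodule.subset_span (Or.inl ⟨σ, hν, rfl⟩)
  · rintro _ hτ σ rfl
    exact Submodule.subset_span (Or.inr (Or.inl ⟨σ, hτ, rfl⟩))
  · rintro _ τ h ih σ rfl
    let τ' : Simplex K n := ⟨τ, h.right_mem, by
      have := σ.2.2
      rw [h.card_eq]
      push_cast
      omega⟩
    have hτ' : boundary K n p (Finsupp.single τ' 1) ∈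
        Submodule.span (ZMod 2) (generators W W.IsUpperRegular (boundary K) n p) :=
      Submodule.subset_span (Or.inr (Or.inr ⟨τ', ⟨_, h⟩, rfl⟩))
    rw [← sub_sub_cancel (boundary K n p (Finsupp.single τ' 1)) (Finsupp.single σ 1)]
    refine Submodule.sub_mem _ hτ' (mem_of_forall_single_mem fun ρ hρ => ?_)
    rw [Finsupp.sub_apply, boundary_single_apply] at hρ
    -- The face `σ` has coefficient 1 in `∂τ`, so it cancels in the difference.
    have hne : ρ ≠ σ := by
      rintro rfl
      refine hρ ?_
      rw [if_pos ⟨by omega, h.ssubset⟩]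
      simp
    rw [Finsupp.single_eq_of_ne hne, sub_zero] at hρ
    exact ih ρ.1 ρ.2.1 (ite_ne_right_iff.1 hρ).1.2 (fun h => hne (Subtype.ext h)) ρ rfl

/-- Dual triangularity: `τ` has coefficient 1 in `δσ`, and the other faces in `δσ` come later in the
sequence, so the induction runs backward. -/
theorem span_generators_coboundary {n p : ℤ} (hn : n = p - 1) :
    ⊤ ≤ Submodule.span (ZMod 2) (generators W W.IsLowerRegular (coboundary K) n p) := by
  classical
  intro x _
  refine mem_of_forall_single_mem fun σ _ => ?_
  suffices ∀ ρ ∈ K, ∀ σ : Simplex K p, σ.1 = ρ → Finsupp.single σ 1 ∈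
      Submodule.span (ZMod 2) (generators W W.IsLowerRegular (coboundary K) n p) from
    this σ.1 σ.2.1 σ rfl
  intro ρ hρ
  refine backward_induction (W := W) (P := fun ρ =>
      ∀ σ : Simplex K p, σ.1 = ρ → Finsupp.single σ 1 ∈
      Submodule.span (ZMod 2) (generators W W.IsLowerRegular (coboundary K) n p)) ?_ ?_ ?_ hρ
  · rintro _ hν σ rfl
    exact Submodule.subset_span (Or.inl ⟨σ, hν, rfl⟩)
  · rintro _ hτ σ rfl
    exact Submodule.subset_span (Or.inr (Or.inl ⟨σ, hτ, rfl⟩))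
  · rintro σ _ h ih τ rfl
    let σ' : Simplex K n := ⟨σ, h.left_mem, by
      have := τ.2.2
      rw [h.card_eq] at this
      push_cast at this
      omega⟩
    have hσ' : coboundary K n p (Finsupp.single σ' 1) ∈
        Submodule.span (ZMod 2) (generators W W.IsLowerRegular (coboundary K) n p) :=
      Submodule.subset_span (Or.inr (Or.inr ⟨σ', ⟨_, h⟩, rfl⟩))
    rw [← sub_sub_cancel (coboundary K n p (Finsupp.single σ' 1)) (Finsupp.single τ 1)]
    refine Submodule.sub_mem _ hσ' (mem_of_forall_single_mem fun ρ hρ => ?_)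
    rw [Finsupp.sub_apply, coboundary_single_apply] at hρ
    have hne : ρ ≠ τ := by
      rintro rfl
      refine hρ ?_
      rw [if_pos ⟨by omega, h.ssubset⟩]
      simp
    rw [Finsupp.single_eq_of_ne hne, sub_zero] at hρ
    exact ih ρ.1 ρ.2.1 (ite_ne_right_iff.1 hρ).1.2 (fun h => hne (Subtype.ext h)) ρ rfl

theorem isAcyclicMatching_boundary :
    IsAcyclicMatching W W.IsUpperRegular W.IsLowerRegular (boundary K) (coboundary K) 1 where
  critical_not _ h := h.not_isUpperRegular
  critical_not' _ h := h.not_isLowerRegular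
  not_of _ h := h.not_isUpperRegular
  cover _ σ := isCritical_or σ.2.1
  transpose p q σ τ := coboundary_single_apply_eq q p τ σ
  comp_eq_zero := boundary_comp_boundary
  map_eq_zero n p h := boundary_eq_zero (by omega)
  span _ _ h := span_generators_boundary h
  span' _ _ h := span_generators_coboundary h
  exists_mate := by
    refine ⟨W.IsRegularPair, fun σ τ τ' h h' => (h.eq_of_mem h' (Or.inl rfl) (Or.inl rfl)).2, ?_⟩
    rintro n p hn
    refine ⟨?_, ?_⟩
    · rintro σ ⟨τ, h⟩
      have := σ.2.2
      exact ⟨⟨τ, h.right_mem, by rw [h.card_eq]; push_cast; omega⟩, h⟩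
    · rintro τ ⟨σ, h⟩
      have := τ.2.2
      rw [h.card_eq] at this
      push_cast at this
      exact ⟨⟨σ, h.left_mem, by omega⟩, ⟨_, h⟩, h⟩

/-- The coboundary raises degree, hence the shift `-1`; the mate of an upper regular face is now its
lower one. -/
theorem isAcyclicMatching_coboundary :
    IsAcyclicMatching W W.IsLowerRegular W.IsUpperRegular (coboundary K) (boundary K) (-1) where
  critical_not _ h := h.not_isLowerRegular
  critical_not' _ h := h.not_isUpperRegular
  not_of _ h h' := h'.not_isUpperRegular h
  cover _ σ := (isCritical_or σ.2.1).imp_right Or.symm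
  transpose p q σ τ := (coboundary_single_apply_eq p q σ τ).symm
  comp_eq_zero := coboundary_comp_coboundary
  map_eq_zero n p h := coboundary_eq_zero (by omega)
  span _ _ h := span_generators_coboundary (by omega)
  span' _ _ h := span_generators_boundary (by omega)
  exists_mate := by
    refine ⟨fun τ σ => W.IsRegularPair σ τ,
      fun τ σ σ' h h' => (h.eq_of_mem h' (Or.inr rfl) (Or.inr rfl)).1, ?_⟩
    rintro n p hn
    refine ⟨?_, ?_⟩
    · rintro τ ⟨σ, h⟩
      have := τ.2.2
      rw [h.card_eq] at this
      push_cast at this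
      exact ⟨⟨σ, h.left_mem, by omega⟩, h⟩
    · rintro σ ⟨τ, h⟩
      have := σ.2.2
      exact ⟨⟨τ, h.right_mem, by rw [h.card_eq]; push_cast; omega⟩, ⟨_, h⟩, h⟩

/-- `IsReferenceFor` imposes vanishing in every target degree, but only `q = p - 1` gives a
condition since the other components of the boundary are zero. -/
theorem isReferenceMap_iff {Υ : W.Frame} :
    IsReferenceMap Υ ↔ IsReferenceFor W.IsUpperRegular (boundary K) Υ := by
  refine ⟨fun h => ⟨h.critical, h.upper, fun p q τ hτ => ?_⟩,
    fun h => ⟨h.critical, h.vanish, fun p τ hτ => h.vanish_map _ _ τ hτ⟩⟩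
  by_cases hq : q = p - 1
  · subst hq
    exact h.boundary_upper p τ hτ
  · rw [boundary_eq_zero hq, LinearMap.zero_apply, map_zero]

theorem isCoreferenceMap_iff {Υ : W.Frame} :
    IsCoreferenceMap Υ ↔ IsReferenceFor W.IsLowerRegular (coboundary K) Υ := by
  refine ⟨fun h => ⟨h.critical, h.lower, fun p q τ hτ => ?_⟩,
    fun h => ⟨h.critical, h.vanish, fun p τ hτ => h.vanish_map _ _ τ hτ⟩⟩
  by_cases hq : q = p + 1
  · subst hq
    exact h.coboundary_lower p τ hτ
  · rw [coboundary_eq_zero hq, LinearMap.zero_apply, map_zero]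

end Regular

end MorseSeq

/-! ### The main theorem -/

theorem mainTheorem1 {V : Type*} (K : PreAbstractSimplicialComplex V) [Finite K]
    (W : MorseSequence K) :
    (∃! ref : W.Frame, IsReferenceMap ref) ∧ (∃! coref : W.Frame, IsCoreferenceMap coref) ∧
    ∀ ref coref : W.Frame, IsReferenceMap ref → IsCoreferenceMap coref → ∀ p : ℤ,
      -- the four sequences are complexes
      (boundary K p (p - 1) ∘ₗ boundary K (p + 1) p = 0 ∧
        criticalBoundary ref p (p - 1) ∘ₗ criticalBoundary ref (p + 1) p = 0 ∧
        coboundary K p (p + 1) ∘ₗ coboundary K (p - 1) p = 0 ∧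
        cocriticalCoboundary coref p (p + 1) ∘ₗ cocriticalCoboundary coref (p - 1) p = 0) ∧
      -- the reference and extension maps are chain maps, the dual ones are cochain maps
      (criticalBoundary ref p (p - 1) ∘ₗ frameMap ref p =
          frameMap ref (p - 1) ∘ₗ boundary K p (p - 1) ∧
        boundary K p (p - 1) ∘ₗ extensionMap coref p =
          extensionMap coref (p - 1) ∘ₗ criticalBoundary ref p (p - 1) ∧
        cocriticalCoboundary coref p (p + 1) ∘ₗ frameMap coref p =
          frameMap coref (p + 1) ∘ₗ coboundary K p (p + 1) ∧
        coboundary K p (p + 1) ∘ₗ coextensionMap ref p =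
          coextensionMap ref (p + 1) ∘ₗ cocriticalCoboundary coref p (p + 1)) ∧
      -- they induce mutually inverse isomorphisms in homology and in cohomology
      (∃ e : SimplicialHomology K p ≃ₗ[ZMod 2] CriticalHomology ref p,
        IsInducedBy e.toLinearMap (frameMap ref p) ∧
        IsInducedBy e.symm.toLinearMap (extensionMap coref p)) ∧
      (∃ e : SimplicialCohomology K p ≃ₗ[ZMod 2] CocriticalCohomology coref p,
        IsInducedBy e.toLinearMap (frameMap coref p) ∧
        IsInducedBy e.symm.toLinearMap (coextensionMap ref p)) := by
  simp only [isReferenceMap_iff, isCoreferenceMap_iff]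
  -- Each cohomological claim is the homological one for `M'`, with the roles of `ref` and `coref`
  -- exchanged.
  have M := isAcyclicMatching_boundary (W := W)
  have M' := isAcyclicMatching_coboundary (W := W)
  refine ⟨M.existsUnique, M'.existsUnique, fun ref coref h h' p => ⟨⟨?_, ?_, ?_, ?_⟩,
    ⟨?_, ?_, ?_, ?_⟩, ?_, ?_⟩⟩
  · exact boundary_comp_boundary _ _ _
  · exact M.critical_comp h _ _ _
  · exact coboundary_comp_coboundary _ _ _
  · exact M'.critical_comp h' _ _ _
  · exact M.critical_comp_frameMap h _ _
  · exact M.comp_transposeMap h h' _ _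
  · exact M'.critical_comp_frameMap h' _ _
  · exact M'.comp_transposeMap h' h _ _
  · exact M.exists_homology_equiv h h' rfl rfl
  · exact M'.exists_homology_equiv h' h (by omega) (by omega)
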